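/- Let $X\in\mathbb{R}^{n\times d}$ be a data matrix with rows $x_1,\dots,x_n$ and let $y\in\{-1,1\}^n$ be labels. Let $D_1,\dots,D_P$ be activation patterns of $X$, i.e. matrices of the form $\mathrm{diag}(\mathbf 1\{Xu\ge 0\})$ with $u\in\mathbb{R}^d$ (for instance, a list of all of them). For $\theta=(u_1',u_1,\dots,u_P',u_P)\in\mathbb{R}^{2dP}$ with $u_i,u_i'\in\mathbb{R}^d$ put $$f^{\text{two-layer}}(x_k;\theta)=\Big(\sum_{i=1}^P D_iX(u_i'-u_i)\Big)_k ,$$ and let $\mathcal C(\{k\})$ and $\mathcal C'(\{k\})$ be the constraints $((2D_i-I)Xu_i)_k\ge 0$ for all $i$ and $((2D_i-I)Xu_i')_k\ge 0$ for all $i$, respectively. A convex body is a compact convex set with non-empty interior, and $\theta_G(\mathcal T)=\frac1{\mathrm{vol}(\mathcal T)}\int_{\mathcal T}\theta\,d\theta$ is the center of gravity of a convex body $\mathcal T\subseteq\mathbb{R}^{2dP}$. The cut of $\mathcal T$ by the data point $(x_k,y_k)$ is called active if $\theta_G(\mathcal T)$ misclassifies it, i.e. $y_k f^{\text{two-layer}}(x_k;\theta_G(\mathcal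 T))<0$. (1) Let $\mathcal T\subseteq\mathbb{R}^{2dP}$ be a convex body and let $(x_k,y_k)$ be a data point whose cut of $\mathcal T$ is active. Then $\mathcal T$ is the disjoint union of $$\mathcal T_1=\{\theta\in\mathcal T: y_kf^{\text{two-layer}}(x_k;\theta)\ge 0,\ \mathcal C(\{k\}),\ \mathcal C'(\{k\})\}$$ and $$\mathcal T_2=\{\theta\in\mathcal T: y_kf^{\text{two-layer}}(x_k;\theta)<0\ \text{or}\ \neg\mathcal C(\{k\})\ \text{or}\ \neg\mathcal C'(\{k\})\},$$ and $$\mathrm{vol}(\mathcal T_1)<\Big(1-\frac1e\Big)\mathrm{vol}(\mathcal T).$$ (2) Let $t\ge 1$, let $\mathcal T^0\subseteq\mathbb{R}^{2dP}$ be a convex body, and let $\mathcal T^1,\dots,\mathcal T^t$ be obtained by $t$ successive active cuts: for every $s<t$, $\mathcal T^s$ is a convex body (so that its center of gravity is defined) and $\mathcal T^{s+1}$ is the set $\mathcal T_1$ of part (1) formed from $\mathcal T=\mathcal T^s$ and a data point $(x_{k_s},y_{k_s})$ misclassified by $\theta_G(\mathcal T^s)$. Then $$\mathrm{vol}(\mathcal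 T^t)<\Big(1-\frac1e\Big)^t\,\mathrm{vol}(\mathcal T^0).$$ -/

import Mathlib

open MeasureTheory

namespace CuttingPlane

noncomputable section

/-- The set of activation patterns `diag(1{X u ≥ 0})`, `u ∈ ℝ^d`, of a data matrix `X` whose
rows are the data points `x_1, …, x_n`. -/
def activationPatterns {n d : ℕ} (X : Matrix (Fin n) (Fin d) ℝ) :
    Set (Matrix (Fin n) (Fin n) ℝ) :=
  Set.range fun u : Fin d → ℝ =>
    Matrix.diagonal fun k => if 0 ≤ X.mulVec u k then (1 : ℝ) else 0

/-- The parameter space `ℝ^(2dP)` of vectors `θ = (u'_1, u_1, …, u'_P, u_P)` with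
`u_i, u'_i ∈ ℝ^d`, with its Euclidean structure and Lebesgue measure. -/
abbrev Param (P d : ℕ) : Type := EuclideanSpace ℝ (Fin P × Fin 2 × Fin d)

/-- The block `u'_i` of `θ = (u'_1, u_1, …, u'_P, u_P)`. -/
def uPrime {P d : ℕ} (θ : Param P d) (i : Fin P) : Fin d → ℝ := fun j => θ (i, 0, j)

/-- The block `u_i` of `θ = (u'_1, u_1, …, u'_P, u_P)`. -/
def uBlock {P d : ℕ} (θ : Param P d) (i : Fin P) : Fin d → ℝ := fun j => θ (i, 1, j)

variable {n d P : ℕ}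

/-- The prediction vector `∑ i, D_i X (u'_i - u_i)`; its `k`-th entry is the prediction
`f(x_k; θ)` at the `k`-th data point. -/
def twoLayer (X : Matrix (Fin n) (Fin d) ℝ) (D : Fin P → activationPatterns X)
    (θ : Param P d) : Fin n → ℝ :=
  ∑ i, ((D i : Matrix (Fin n) (Fin n) ℝ) * X).mulVec (uPrime θ i - uBlock θ i)

/-- The ReLU sign constraints `((2 D_i - I) X)_k u_i ≥ 0` for all `i`. -/
def reluC (X : Matrix (Fin n) (Fin d) ℝ) (D : Fin P → activationPatterns X)
    (k : Fin n) (θ : Param P d) : Prop :=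
  ∀ i, 0 ≤ ((2 * (D i : Matrix (Fin n) (Fin n) ℝ) - 1) * X).mulVec (uBlock θ i) k

/-- The ReLU sign constraints `((2 D_i - I) X)_k u'_i ≥ 0` for all `i`. -/
def reluC' (X : Matrix (Fin n) (Fin d) ℝ) (D : Fin P → activationPatterns X)
    (k : Fin n) (θ : Param P d) : Prop :=
  ∀ i, 0 ≤ ((2 * (D i : Matrix (Fin n) (Fin n) ℝ) - 1) * X).mulVec (uPrime θ i) k

/-- The part of `T` that is kept by the polyhedral cut of the data point `(x_k, y_k)`. -/
def cutKept (X : Matrix (Fin n) (Fin d) ℝ) (y : Fin n → ℝ) (D : Fin P → activationPatterns X)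
    (T : Set (Param P d)) (k : Fin n) : Set (Param P d) :=
  {θ ∈ T | 0 ≤ y k * twoLayer X D θ k ∧ reluC X D k θ ∧ reluC' X D k θ}

/-- The part of `T` that is discarded by the polyhedral cut of the data point `(x_k, y_k)`. -/
def cutDiscarded (X : Matrix (Fin n) (Fin d) ℝ) (y : Fin n → ℝ)
    (D : Fin P → activationPatterns X) (T : Set (Param P d)) (k : Fin n) : Set (Param P d) :=
  {θ ∈ T | y k * twoLayer X D θ k < 0 ∨ ¬ reluC X D k θ ∨ ¬ reluC' X D k θ}

/-- A compact convex set with non-empty interior. -/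
structure IsConvexBody (T : Set (Param P d)) : Prop where
  isCompact : IsCompact T
  convex : Convex ℝ T
  interior_nonempty : (interior T).Nonempty

/-- The center of gravity `vol(T)⁻¹ ∫_T θ dθ`. For a set of volume zero this is the junk
value `0`, at which every prediction vanishes, so that no cut is active there. -/
def centroid (T : Set (Param P d)) : Param P d :=
  (volume.real T)⁻¹ • ∫ θ in T, θ

/-- The cut of `T` by the data point `(x_k, y_k)` is active: the center of gravity of `T`
misclassifies that point. -/
def IsActive (X : Matrix (Fin n) (Fin d) ℝ) (y : Fin n → ℝ) (D : Fin P → activationPatterns X)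
    (T : Set (Param P d)) (k : Fin n) : Prop :=
  y k * twoLayer X D (centroid T) k < 0

end

end CuttingPlane

namespace CuttingPlane

open scoped ENNReal


/-! The label times the prediction is a linear functional `l` of the parameter, and activity says
that `l < 0` at the center of gravity. The kept part lies in `T ∩ {0 ≤ l}`, so the bound for one cut
is Grünbaum's inequality (`volume_halfSpace_lt`), which is then iterated.

For Grünbaum, `F s = vol (T ∩ {l < s})` is log-concave by Brunn–Minkowski, a consequence of
Prékopa–Leindler (on the line via superlevel sets, in higher dimension via Fubini). If `F 0 ≤ V /
e`, a supporting exponential gives `F s ≤ V * exp (c * s - 1)`. Together with `F ≤ V` this bounds `∫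
F (M - u)` over `u > 0` by `M * V`. But that integral equals `M * V - ∫_T l`, which is larger
because `l` has negative mean (`div_exp_lt_of_logConcave`). -/

/-! ### Brunn–Minkowski on the line -/

/-- The translates `A + min B` and `max A + B` lie in `C` and share only the point `max A + min B`.
-/
theorem volume_add_volume_le_of_isCompact {A B C : Set ℝ} (hA : IsCompact A) (hB : IsCompact B)
    (hA' : A.Nonempty) (hB' : B.Nonempty) (hC : ∀ a ∈ A, ∀ b ∈ B, a + b ∈ C) :
    volume A + volume B ≤ volume C := by
  obtain ⟨a, ha, hamax⟩ := hA.exists_isGreatest hA'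
  obtain ⟨b, hb, hbmin⟩ := hB.exists_isLeast hB'
  have hAv : volume ((fun x => x + b) '' A) = volume A := by simp
  have hBv : volume ((fun x => a + x) '' B) = volume B := by simp
  have hBm : MeasurableSet ((fun x => a + x) '' B) :=
    (hB.image (by fun_prop)).measurableSet
  have hdisj : AEDisjoint volume ((fun x => x + b) '' A) ((fun x => a + x) '' B) := by
    refine measure_mono_null (t := {a + b}) ?_ (by simp)
    rintro z ⟨⟨x, hx, rfl⟩, ⟨w, hw, hwx⟩⟩
    have h1 := hamax hx
    have h2 := hbmin hw
    simp only [Set.mem_singleton_iff] at hwx ⊢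
    linarith
  rw [← hAv, ← hBv, ← measure_union₀ hBm.nullMeasurableSet hdisj]
  refine measure_mono ?_
  rintro z (⟨x, hx, rfl⟩ | ⟨x, hx, rfl⟩)
  · exact hC x hx b hb
  · exact hC a ha x hx

theorem volume_add_volume_le {A B C : Set ℝ} (hA : MeasurableSet A) (hB : MeasurableSet B)
    (hA' : A.Nonempty) (hB' : B.Nonempty) (hC : ∀ a ∈ A, ∀ b ∈ B, a + b ∈ C) :
    volume A + volume B ≤ volume C := by
  obtain ⟨a, ha⟩ := hA'
  obtain ⟨b, hb⟩ := hB'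
  rw [hA.measure_eq_iSup_isCompact, hB.measure_eq_iSup_isCompact]
  simp only [iSup_and']
  refine ENNReal.biSup_add_biSup_le' ⟨∅, by simp⟩ ⟨∅, by simp⟩ ?_
  rintro K ⟨hKA, hK⟩ L ⟨hLB, hL⟩
  -- An approximating compact set may be empty; adjoining `a` and `b` rules this out.
  calc volume K + volume L ≤ volume (insert a K) + volume (insert b L) := by
        gcongr <;> exact Set.subset_insert _ _
    _ ≤ volume C := volume_add_volume_le_of_isCompact (hK.insert a) (hL.insert b)
        (Set.insert_nonempty _ _) (Set.insert_nonempty _ _) fun x hx w hw =>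
          hC x (Set.insert_subset ha hKA hx) w (Set.insert_subset hb hLB hw)

theorem volume_convexCombo_le {t : ℝ} (ht0 : 0 < t) (ht1 : t < 1) {A B C : Set ℝ}
    (hA : MeasurableSet A) (hB : MeasurableSet B) (hA' : A.Nonempty) (hB' : B.Nonempty)
    (hC : ∀ a ∈ A, ∀ b ∈ B, (1 - t) * a + t * b ∈ C) :
    ENNReal.ofReal (1 - t) * volume A + ENNReal.ofReal t * volume B ≤ volume C := by
  open scoped Pointwise in
  have hs : ∀ (r : ℝ), 0 < r → ∀ S : Set ℝ, volume (r • S) = ENNReal.ofReal r * volume S := by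
    intro r hr S
    rw [Measure.addHaar_smul]
    simp [abs_of_pos hr]
  rw [← hs _ (sub_pos.2 ht1), ← hs _ ht0]
  refine volume_add_volume_le (hA.const_smul₀ _) (hB.const_smul₀ _) hA'.smul_set hB'.smul_set ?_
  rintro _ ⟨a, ha, rfl⟩ _ ⟨b, hb, rfl⟩
  exact hC a ha b hb

/-! ### Prékopa–Leindler on the line -/

/-- The Prékopa–Leindler inequality holds for the measure `μ`. -/
def PrekopaLeindler {E : Type*} [AddCommGroup E] [Module ℝ E] [MeasurableSpace E]
    (μ : Measure E) : Prop :=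
  ∀ t : ℝ, 0 < t → t < 1 → ∀ f g h : E → ℝ≥0∞, Measurable f → Measurable g → Measurable h →
    (∀ x y, f x ^ (1 - t) * g y ^ t ≤ h ((1 - t) • x + t • y)) →
    (∫⁻ x, f x ∂μ) ^ (1 - t) * (∫⁻ x, g x ∂μ) ^ t ≤ ∫⁻ x, h x ∂μ

theorem lintegral_eq_lintegral_meas_of_le_one {f : ℝ → ℝ≥0∞} (hf : Measurable f)
    (hf1 : ∀ x, f x ≤ 1) :
    ∫⁻ x, f x = ∫⁻ r in Set.Ioo (0 : ℝ) 1, volume {x | ENNReal.ofReal r < f x} := by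
  have hne : ∀ x, f x ≠ ∞ := fun x => ne_top_of_le_ne_top (by simp) (hf1 x)
  have h1 : ∫⁻ x, f x = ∫⁻ x, ENNReal.ofReal (f x).toReal :=
    lintegral_congr fun x => (ENNReal.ofReal_toReal (hne x)).symm
  rw [h1, lintegral_eq_lintegral_meas_lt _ (by filter_upwards with x; simp)
    hf.ennreal_toReal.aemeasurable]
  have h2 : ∀ r : ℝ, 0 ≤ r → {x | r < (f x).toReal} = {x | ENNReal.ofReal r < f x} := by
    intro r hr
    ext x
    exact (ENNReal.ofReal_lt_iff_lt_toReal hr (hne x)).symm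
  rw [← Set.Ioo_union_Ici_eq_Ioi (zero_lt_one : (0 : ℝ) < 1),
    lintegral_union measurableSet_Ici
      (Set.disjoint_left.2 fun x hx hx' => absurd hx.2 (not_lt.2 hx'))]
  have h3 : ∫⁻ r in Set.Ici (1 : ℝ), volume {x | r < (f x).toReal} = 0 := by
    rw [setLIntegral_congr_fun (g := fun _ => 0) measurableSet_Ici]
    · simp
    · intro r hr
      have : {x | r < (f x).toReal} = ∅ := by
        ext x
        have := ENNReal.toReal_mono (by simp) (hf1 x)
        simp only [ENNReal.toReal_one] at this
        simpa using this.trans hr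
      simp [this]
  rw [h3, add_zero]
  exact setLIntegral_congr_fun measurableSet_Ioo fun r hr => by simp only [h2 r hr.1.le]

/-- Supremum `1` makes the superlevel sets of `f` and `g` nonempty at every level `r < 1`, so
one-dimensional Brunn–Minkowski applies level by level; integrating over `r` gives the bound. -/
theorem prekopaLeindler_real_of_iSup_eq_one {t : ℝ} (ht0 : 0 < t) (ht1 : t < 1)
    {f g h : ℝ → ℝ≥0∞} (hf : Measurable f) (hg : Measurable g) (hh : Measurable h)
    (hf1 : ⨆ x, f x = 1) (hg1 : ⨆ x, g x = 1)
    (H : ∀ x y, f x ^ (1 - t) * g y ^ t ≤ h ((1 - t) * x + t * y)) :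
    ENNReal.ofReal (1 - t) * (∫⁻ x, f x) + ENNReal.ofReal t * (∫⁻ x, g x) ≤ ∫⁻ x, h x := by
  have hfl : ∀ x, f x ≤ 1 := fun x => hf1 ▸ le_iSup f x
  have hgl : ∀ x, g x ≤ 1 := fun x => hg1 ▸ le_iSup g x
  have hmeas : ∀ u : ℝ → ℝ≥0∞, Measurable fun r : ℝ => volume {x | ENNReal.ofReal r < u x} := by
    intro u
    refine Antitone.measurable fun r s hrs => measure_mono fun x hx => ?_
    exact lt_of_le_of_lt (ENNReal.ofReal_le_ofReal hrs) hx
  calc ENNReal.ofReal (1 - t) * (∫⁻ x, f x) + ENNReal.ofReal t * (∫⁻ x, g x)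
      = ∫⁻ r in Set.Ioo (0 : ℝ) 1, (ENNReal.ofReal (1 - t) * volume {x | ENNReal.ofReal r < f x} +
          ENNReal.ofReal t * volume {x | ENNReal.ofReal r < g x}) := by
        rw [lintegral_eq_lintegral_meas_of_le_one hf hfl,
          lintegral_eq_lintegral_meas_of_le_one hg hgl,
          lintegral_add_left ((hmeas f).const_mul _), lintegral_const_mul _ (hmeas f),
          lintegral_const_mul _ (hmeas g)]
    _ ≤ ∫⁻ r in Set.Ioo (0 : ℝ) 1, volume {x | ENNReal.ofReal r < min (h x) 1} := by
        refine setLIntegral_mono (hmeas _) fun r hr => ?_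
        have hr1 : ENNReal.ofReal r < 1 := by simpa using hr.2
        refine volume_convexCombo_le ht0 ht1 (measurableSet_lt measurable_const hf)
          (measurableSet_lt measurable_const hg) (lt_iSup_iff.1 (hr1.trans_eq hf1.symm))
          (lt_iSup_iff.1 (hr1.trans_eq hg1.symm)) fun a ha b hb => lt_min (lt_of_lt_of_le ?_ (H a b)) hr1
        have h0 : ENNReal.ofReal r ≠ 0 := by simpa using hr.1
        calc ENNReal.ofReal r
            = ENNReal.ofReal r ^ (1 - t) * ENNReal.ofReal r ^ t := by
              rw [← ENNReal.rpow_add _ _ h0 (by simp)]; simp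
          _ < f a ^ (1 - t) * g b ^ t :=
              ENNReal.mul_lt_mul (ENNReal.rpow_lt_rpow ha (sub_pos.2 ht1))
                (ENNReal.rpow_lt_rpow hb ht0)
    _ = ∫⁻ x, min (h x) 1 :=
        (lintegral_eq_lintegral_meas_of_le_one (hh.min measurable_const) fun x =>
          min_le_right _ _).symm
    _ ≤ ∫⁻ x, h x := lintegral_mono fun x => min_le_left _ _

theorem ennreal_geom_mean_le_arith_mean {t : ℝ} (ht0 : 0 < t) (ht1 : t < 1) (a b : ℝ≥0∞) :
    a ^ (1 - t) * b ^ t ≤ ENNReal.ofReal (1 - t) * a + ENNReal.ofReal t * b := by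
  have h1 : 0 < 1 - t := sub_pos.2 ht1
  rcases eq_or_ne a ∞ with rfl | ha
  · rw [ENNReal.mul_top (by simpa using h1)]; simp
  rcases eq_or_ne b ∞ with rfl | hb
  · rw [ENNReal.mul_top (by simpa using ht0)]; simp
  lift a to NNReal using ha
  lift b to NNReal using hb
  rw [← ENNReal.coe_rpow_of_nonneg _ h1.le, ← ENNReal.coe_rpow_of_nonneg _ ht0.le]
  have := NNReal.geom_mean_le_arith_mean2_weighted (1 - t).toNNReal t.toNNReal a b
    (by rw [← Real.toNNReal_add h1.le ht0.le]; simp)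
  rw [Real.coe_toNNReal _ h1.le, Real.coe_toNNReal _ ht0.le] at this
  rw [ENNReal.ofReal, ENNReal.ofReal]
  exact_mod_cast this

/-- Both sides scale alike, so `f` and `g` can be divided by their suprema; AM–GM then turns the
arithmetic mean of the normalized case into the geometric one. -/
theorem prekopaLeindler_real_of_iSup_ne_top {t : ℝ} (ht0 : 0 < t) (ht1 : t < 1)
    {f g h : ℝ → ℝ≥0∞} (hf : Measurable f) (hg : Measurable g) (hh : Measurable h)
    (hfb : ⨆ x, f x ≠ ∞) (hgb : ⨆ x, g x ≠ ∞)
    (H : ∀ x y, f x ^ (1 - t) * g y ^ t ≤ h ((1 - t) * x + t * y)) :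
    (∫⁻ x, f x) ^ (1 - t) * (∫⁻ x, g x) ^ t ≤ ∫⁻ x, h x := by
  have h1 : 0 < 1 - t := sub_pos.2 ht1
  set a := ⨆ x, f x with ha
  set b := ⨆ x, g x with hb
  rcases eq_or_ne a 0 with ha0 | ha0
  · have : ∀ x, f x = 0 := fun x => le_antisymm ((le_iSup f x).trans ha0.le) bot_le
    simp [this, h1]
  rcases eq_or_ne b 0 with hb0 | hb0
  · have : ∀ x, g x = 0 := fun x => le_antisymm ((le_iSup g x).trans hb0.le) bot_le
    simp [this, ht0]
  set c := a ^ (1 - t) * b ^ t with hc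
  have hc0 : c ≠ 0 := mul_ne_zero (by simp [ENNReal.rpow_eq_zero_iff, ha0, hfb])
    (by simp [ENNReal.rpow_eq_zero_iff, hb0, hgb])
  have hct : c ≠ ∞ := ENNReal.mul_ne_top (ENNReal.rpow_ne_top_of_nonneg h1.le hfb)
    (ENNReal.rpow_ne_top_of_nonneg ht0.le hgb)
  have hcinv : c⁻¹ = (a⁻¹) ^ (1 - t) * (b⁻¹) ^ t := by
    rw [ENNReal.inv_rpow, ENNReal.inv_rpow, hc, ENNReal.mul_inv]
    · exact Or.inr (ENNReal.rpow_ne_top_of_nonneg ht0.le hgb)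
    · exact Or.inl (ENNReal.rpow_ne_top_of_nonneg h1.le hfb)
  have key : ∀ u v : ℝ≥0∞, (a⁻¹ * u) ^ (1 - t) * (b⁻¹ * v) ^ t = c⁻¹ * (u ^ (1 - t) * v ^ t) := by
    intro u v
    rw [ENNReal.mul_rpow_of_nonneg _ _ h1.le, ENNReal.mul_rpow_of_nonneg _ _ ht0.le, hcinv]
    ring
  have hmain := (ennreal_geom_mean_le_arith_mean ht0 ht1 _ _).trans
    (prekopaLeindler_real_of_iSup_eq_one ht0 ht1 (hf.const_mul a⁻¹) (hg.const_mul b⁻¹)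
      (hh.const_mul c⁻¹)
      (by rw [← ENNReal.mul_iSup, ENNReal.inv_mul_cancel ha0 hfb])
      (by rw [← ENNReal.mul_iSup, ENNReal.inv_mul_cancel hb0 hgb])
      (fun x y => by rw [key]; gcongr; exact H x y))
  rw [lintegral_const_mul _ hf, lintegral_const_mul _ hg, lintegral_const_mul _ hh, key] at hmain
  exact (ENNReal.mul_le_mul_iff_right (ENNReal.inv_ne_zero.2 hct) (ENNReal.inv_ne_top.2 hc0)).1 hmain

/-- Monotone convergence, used to remove the boundedness assumption. -/
theorem lintegral_rpow_eq_iSup_min {t : ℝ} (ht : 0 < t) {f : ℝ → ℝ≥0∞} (hf : Measurable f) :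
    (∫⁻ x, f x) ^ t = ⨆ n : ℕ, (∫⁻ x, min (f x) n) ^ t := by
  have h1 : ∀ x, f x = ⨆ n : ℕ, min (f x) n := by
    intro x
    rw [← inf_iSup_eq, ENNReal.iSup_natCast, inf_top_eq]
  have h2 : ∫⁻ x, f x = ⨆ n : ℕ, ∫⁻ x, min (f x) n := by
    rw [← lintegral_iSup (fun n => hf.min measurable_const)]
    · exact lintegral_congr h1
    · intro m n hmn x
      exact min_le_min_left _ (by exact_mod_cast hmn)
  rw [h2]
  exact (ENNReal.orderIsoRpow t ht).map_iSup _

theorem prekopaLeindler_real : PrekopaLeindler (volume : Measure ℝ) := by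
  intro t ht0 ht1 f g h hf hg hh H
  have hb : ∀ (u : ℝ → ℝ≥0∞) (n : ℕ), ⨆ x, min (u x) n ≠ ∞ := fun u n =>
    ne_top_of_le_ne_top (ENNReal.natCast_ne_top n) (iSup_le fun x => min_le_right _ _)
  rw [lintegral_rpow_eq_iSup_min (sub_pos.2 ht1) hf, lintegral_rpow_eq_iSup_min ht0 hg]
  rw [ENNReal.iSup_mul]
  refine iSup_le fun m => ?_
  rw [ENNReal.mul_iSup]
  refine iSup_le fun n => ?_
  refine prekopaLeindler_real_of_iSup_ne_top ht0 ht1 (hf.min measurable_const)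
    (hg.min measurable_const) hh (hb f m) (hb g n) fun x y => le_trans ?_ (H x y)
  have := (sub_pos.2 ht1).le
  gcongr <;> exact min_le_left _ _

/-! ### Prékopa–Leindler and Brunn–Minkowski in higher dimension -/

/-- The inequality for `ν` on slices is exactly the hypothesis of the inequality for `μ` on the
slice integrals. -/
theorem PrekopaLeindler.prod {E F : Type*} [AddCommGroup E] [Module ℝ E] [MeasurableSpace E]
    [AddCommGroup F] [Module ℝ F] [MeasurableSpace F] {μ : Measure E} {ν : Measure F}
    [SFinite μ] [SFinite ν] (hμ : PrekopaLeindler μ) (hν : PrekopaLeindler ν) :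
    PrekopaLeindler (μ.prod ν) := by
  intro t ht0 ht1 f g h hf hg hh H
  rw [lintegral_prod _ hf.aemeasurable, lintegral_prod _ hg.aemeasurable,
    lintegral_prod _ hh.aemeasurable]
  refine hμ t ht0 ht1 _ _ _ hf.lintegral_prod_right' hg.lintegral_prod_right'
    hh.lintegral_prod_right' fun x x' => ?_
  exact hν t ht0 ht1 _ _ _ (hf.comp measurable_prodMk_left) (hg.comp measurable_prodMk_left)
    (hh.comp measurable_prodMk_left) fun y y' => H (x, y) (x', y')

theorem PrekopaLeindler.of_measurePreserving {E F : Type*} [AddCommGroup E] [Module ℝ E]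
    [MeasurableSpace E] [AddCommGroup F] [Module ℝ F] [MeasurableSpace F] {μ : Measure E}
    {ν : Measure F} (hμ : PrekopaLeindler μ) (e : E → F) (he : MeasurePreserving e μ ν)
    (hlin : IsLinearMap ℝ e) : PrekopaLeindler ν := by
  intro t ht0 ht1 f g h hf hg hh H
  rw [← he.lintegral_comp hf, ← he.lintegral_comp hg, ← he.lintegral_comp hh]
  refine hμ t ht0 ht1 _ _ _ (hf.comp he.measurable) (hg.comp he.measurable)
    (hh.comp he.measurable) fun x y => ?_
  simp only [hlin.map_add, hlin.map_smul]
  exact H _ _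

theorem prekopaLeindler_fin (N : ℕ) : PrekopaLeindler (volume : Measure (Fin N → ℝ)) := by
  induction N with
  | zero =>
    intro t ht0 ht1 f g h hf hg hh H
    rw [volume_pi, Measure.pi_of_empty]
    simp only [lintegral_dirac]
    convert! H isEmptyElim isEmptyElim
  | succ N ih =>
    refine (prekopaLeindler_real.prod ih).of_measurePreserving
      (MeasurableEquiv.piFinSuccAbove (fun _ => ℝ) 0).symm
      (volume_preserving_piFinSuccAbove (fun _ => ℝ) 0).symm ⟨?_, ?_⟩
    · intro x y
      ext i
      refine Fin.cases ?_ (fun j => ?_) i <;> simp [MeasurableEquiv.piFinSuccAbove]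
    · intro c x
      ext i
      refine Fin.cases ?_ (fun j => ?_) i <;> simp [MeasurableEquiv.piFinSuccAbove]

/-- The **Prékopa–Leindler inequality**. -/
theorem prekopaLeindler_euclideanSpace (ι : Type*) [Fintype ι] :
    PrekopaLeindler (volume : Measure (EuclideanSpace ℝ ι)) := by
  have h := (prekopaLeindler_fin (Fintype.card ι)).of_measurePreserving _
    (volume_measurePreserving_piCongrLeft (fun _ : ι => ℝ) (Fintype.equivFin ι).symm)
    ⟨fun x y => by
      ext i
      obtain ⟨j, rfl⟩ := (Fintype.equivFin ι).symm.surjective i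
      simp [MeasurableEquiv.coe_piCongrLeft], fun c x => by
      ext i
      obtain ⟨j, rfl⟩ := (Fintype.equivFin ι).symm.surjective i
      simp [MeasurableEquiv.coe_piCongrLeft]⟩
  exact h.of_measurePreserving _ (PiLp.volume_preserving_toLp ι)
    ⟨fun x y => rfl, fun c x => rfl⟩

/-- The multiplicative **Brunn–Minkowski inequality**. -/
theorem PrekopaLeindler.measure_le {E : Type*} [AddCommGroup E] [Module ℝ E] [MeasurableSpace E]
    {μ : Measure E} (hμ : PrekopaLeindler μ) {t : ℝ} (ht0 : 0 < t) (ht1 : t < 1) {A B C : Set E}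
    (hA : MeasurableSet A) (hB : MeasurableSet B) (hC : MeasurableSet C)
    (H : ∀ a ∈ A, ∀ b ∈ B, (1 - t) • a + t • b ∈ C) :
    μ A ^ (1 - t) * μ B ^ t ≤ μ C := by
  have h1 : 0 < 1 - t := sub_pos.2 ht1
  have := hμ t ht0 ht1 (A.indicator 1) (B.indicator 1) (C.indicator 1)
    (measurable_one.indicator hA) (measurable_one.indicator hB) (measurable_one.indicator hC) ?_
  · simpa [lintegral_indicator_one, hA, hB, hC] using this
  intro x y
  by_cases hx : x ∈ A
  · by_cases hy : y ∈ B
    · simp [hx, hy, H x hx y hy]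
    · simp [hy, ht0]
  · simp [hx, h1]


/-! ### Grünbaum's inequality -/

/-- The endpoint `M - 1 / c` is where the exponential bound crosses the trivial bound `V`. -/
theorem lintegral_Ioi_exp_tail {V c M : ℝ} (hV : 0 ≤ V) (hc : 0 < c) :
    ∫⁻ u in Set.Ioi (M - 1 / c), ENNReal.ofReal (V * Real.exp (c * (M - u) - 1)) =
      ENNReal.ofReal (V / c) := by
  have hfun : ∀ u : ℝ, V * Real.exp (c * (M - u) - 1) =
      (V * Real.exp (c * M - 1)) * Real.exp (-c * u) := by
    intro u
    rw [mul_assoc, ← Real.exp_add]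
    ring_nf
  simp_rw [hfun]
  rw [← ofReal_integral_eq_lintegral_ofReal
    ((integrableOn_exp_mul_Ioi (neg_lt_zero.2 hc) _).const_mul _)
    (by filter_upwards with u; positivity), integral_const_mul,
    integral_exp_mul_Ioi (neg_lt_zero.2 hc)]
  congr 1
  have : -c * (M - 1 / c) = -(c * M - 1) := by field_simp
  rw [this, Real.exp_neg]
  field_simp

/-- A supporting exponential at `0` for a log-concave function which is positive at some
negative point. -/
theorem exists_le_mul_exp_of_logConcave {F : ℝ → ℝ} (hF : ∀ s, 0 ≤ F s) (hmono : Monotone F)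
    (hlc : ∀ a b t, 0 < t → t < 1 → F a ^ (1 - t) * F b ^ t ≤ F ((1 - t) * a + t * b))
    (hpos : ∃ s < 0, 0 < F s) :
    ∃ c, ∀ s, F s ≤ F 0 * Real.exp (c * s) := by
  obtain ⟨s₁, hs₁, hFs₁⟩ := hpos
  have hF0 : 0 < F 0 := hFs₁.trans_le (hmono hs₁.le)
  -- Concavity of `log F` at `0`, a convex combination of `s` and `u`: chords to the right are no
  -- steeper than chords to the left. The supremum of the right slopes serves as `c`.
  have hslope : ∀ s < 0, 0 < F s → ∀ u > 0,
      (Real.log (F u) - Real.log (F 0)) / u ≤ (Real.log (F 0) - Real.log (F s)) / (-s) := by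
    intro s hs hFs u hu
    have hFu : 0 < F u := hF0.trans_le (hmono hu.le)
    have hus : 0 < u - s := by linarith
    have h := hlc s u (-s / (u - s)) (div_pos (by linarith) hus)
      ((div_lt_one hus).2 (by linarith))
    have h0 : (1 - -s / (u - s)) * s + -s / (u - s) * u = 0 := by field_simp; ring
    rw [h0] at h
    have hl := Real.log_le_log (by positivity) h
    rw [Real.log_mul (by positivity) (by positivity), Real.log_rpow hFs, Real.log_rpow hFu] at hl
    have h1 : (1 - -s / (u - s)) = u / (u - s) := by field_simp; ring
    rw [h1, div_mul_eq_mul_div, div_mul_eq_mul_div, ← add_div, div_le_iff₀ hus] at hl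
    rw [div_le_div_iff₀ hu (by linarith)]
    linarith
  set S : Set ℝ := (fun u => (Real.log (F u) - Real.log (F 0)) / u) '' Set.Ioi 0 with hS
  have hSne : S.Nonempty := Set.nonempty_Ioi.image _
  have hSb : BddAbove S := ⟨_, by rintro _ ⟨u, hu, rfl⟩; exact hslope s₁ hs₁ hFs₁ u hu⟩
  have hexp : ∀ s c, 0 < F s → Real.log (F s) - Real.log (F 0) ≤ c * s →
      F s ≤ F 0 * Real.exp (c * s) := by
    intro s c hFs h
    rw [← Real.exp_log hFs]
    conv_rhs => rw [← Real.exp_log hF0]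
    rw [← Real.exp_add, Real.exp_le_exp]
    linarith
  refine ⟨sSup S, fun s => ?_⟩
  rcases lt_trichotomy s 0 with hs | rfl | hs
  · rcases (hF s).eq_or_lt with h0 | hFs
    · rw [← h0]; positivity
    · refine hexp s _ hFs ?_
      have : sSup S ≤ (Real.log (F 0) - Real.log (F s)) / (-s) :=
        csSup_le hSne (by rintro _ ⟨u, hu, rfl⟩; exact hslope s hs hFs u hu)
      rw [le_div_iff₀ (by linarith)] at this
      linarith
  · simp
  · refine hexp s _ (hF0.trans_le (hmono hs.le)) ?_
    exact (div_le_iff₀ hs).1 (le_csSup hSb ⟨s, hs, rfl⟩)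

/-- One-dimensional form of Grünbaum's inequality: a log-concave distribution function of total
mass `V`, supported on `(-∞, M]` and with negative mean, exceeds `V / e` at `0`. -/
theorem div_exp_lt_of_logConcave {F : ℝ → ℝ} {V M : ℝ} (hV : 0 < V) (hM : 0 < M)
    (hF : ∀ s, 0 ≤ F s) (hFV : ∀ s, F s ≤ V) (hFM : F M = V) (hmono : Monotone F)
    (hlc : ∀ a b t, 0 < t → t < 1 → F a ^ (1 - t) * F b ^ t ≤ F ((1 - t) * a + t * b))
    (hint : ENNReal.ofReal (M * V) < ∫⁻ u in Set.Ioi 0, ENNReal.ofReal (F (M - u))) :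
    V / Real.exp 1 < F 0 := by
  have hsplit : ∀ m : ℝ, 0 ≤ m → ∫⁻ u in Set.Ioi 0, ENNReal.ofReal (F (M - u)) ≤
      ENNReal.ofReal (m * V) + ∫⁻ u in Set.Ioi m, ENNReal.ofReal (F (M - u)) := by
    intro m hm
    rw [← Set.Ioc_union_Ioi_eq_Ioi hm, lintegral_union measurableSet_Ioi
      (Set.disjoint_left.2 fun x hx hx' => absurd hx' (not_lt.2 hx.2))]
    gcongr
    calc ∫⁻ u in Set.Ioc 0 m, ENNReal.ofReal (F (M - u))
        ≤ ∫⁻ u in Set.Ioc 0 m, ENNReal.ofReal V :=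
          lintegral_mono fun u => ENNReal.ofReal_le_ofReal (hFV _)
      _ = ENNReal.ofReal (m * V) := by
          rw [setLIntegral_const, Real.volume_Ioc, sub_zero, mul_comm m V,
            ENNReal.ofReal_mul hV.le]
  -- Otherwise levels `u > M` contribute nothing and the integral is at most `M * V`.
  have hpos : ∃ s < 0, 0 < F s := by
    by_contra! hcon
    refine absurd (hsplit M hM.le) (not_le.2 ?_)
    rw [setLIntegral_congr_fun (g := fun _ => 0) measurableSet_Ioi]
    · simpa using hint
    · intro u hu
      simpa using hcon (M - u) (sub_neg.2 hu)
  by_contra! hcon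
  obtain ⟨c, hc⟩ := exists_le_mul_exp_of_logConcave hF hmono hlc hpos
  have hbd : ∀ s, F s ≤ V * Real.exp (c * s - 1) := by
    intro s
    refine (hc s).trans ?_
    rw [Real.exp_sub, mul_div_assoc', mul_div_right_comm]
    gcongr
  -- Since `F M = V`, the exponential bound at `M` forces this; hence `c > 0` and the splitting
  -- point `M - 1 / c` is nonnegative.
  have hcM : 1 ≤ c * M := by
    have := hbd M
    rw [hFM, le_mul_iff_one_le_right hV, Real.one_le_exp_iff] at this
    linarith
  have hc0 : 0 < c := pos_of_mul_pos_left (by linarith) hM.le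
  have hm : 0 ≤ M - 1 / c := by
    rw [sub_nonneg, div_le_iff₀ hc0]
    linarith
  refine absurd hint (not_lt.2 ((hsplit _ hm).trans ?_))
  calc ENNReal.ofReal ((M - 1 / c) * V) +
        ∫⁻ u in Set.Ioi (M - 1 / c), ENNReal.ofReal (F (M - u))
      ≤ ENNReal.ofReal ((M - 1 / c) * V) +
        ∫⁻ u in Set.Ioi (M - 1 / c), ENNReal.ofReal (V * Real.exp (c * (M - u) - 1)) := by
        gcongr
        exact hbd _
    _ = ENNReal.ofReal (M * V) := by
        rw [lintegral_Ioi_exp_tail hV.le hc0, ← ENNReal.ofReal_add (by positivity) (by positivity)]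
        congr 1
        ring

/-- **Grünbaum's inequality**: a half-space that does not contain the center of gravity of a
convex body contains less than a fraction `1 - 1 / e` of its volume. -/
theorem volume_halfSpace_lt {ι : Type*} [Fintype ι] {T : Set (EuclideanSpace ℝ ι)}
    (hT : IsCompact T) (hconv : Convex ℝ T) (hV : 0 < volume.real T)
    (l : EuclideanSpace ℝ ι →L[ℝ] ℝ) (hl : ∫ x in T, l x < 0) :
    volume.real (T ∩ {x | 0 ≤ l x}) < (1 - 1 / Real.exp 1) * volume.real T := by
  have hTm := hT.measurableSet
  have hTfin : volume T ≠ ∞ := hT.measure_lt_top.ne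
  have hlm : ∀ s, MeasurableSet {x | l x < s} := fun s =>
    measurableSet_lt l.continuous.measurable measurable_const
  have hfin : ∀ S : Set (EuclideanSpace ℝ ι), volume (T ∩ S) ≠ ∞ := fun S =>
    ne_top_of_le_ne_top hTfin (measure_mono Set.inter_subset_left)
  set F : ℝ → ℝ := fun s => volume.real (T ∩ {x | l x < s}) with hFdef
  obtain ⟨M₀, hM₀⟩ := hT.bddAbove_image l.continuous.continuousOn
  -- The `+ 1` makes `l < M` strict on `T`, so that `F M` is the full volume.
  set M := max M₀ 0 + 1 with hMdef
  have hM : 0 < M := by positivity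
  have hlM : ∀ x ∈ T, l x < M := fun x hx =>
    (hM₀ ⟨x, hx, rfl⟩).trans_lt (by have := le_max_left M₀ 0; linarith)
  have hlint : IntegrableOn l T := l.continuous.continuousOn.integrableOn_compact hT
  have hkey : volume.real T / Real.exp 1 < F 0 := by
    refine div_exp_lt_of_logConcave hV hM (fun s => measureReal_nonneg)
      (fun s => measureReal_mono Set.inter_subset_left hTfin) ?_ ?_ ?_ ?_
    · simp only [hFdef]
      congr 1
      exact Set.inter_eq_left.2 hlM
    · intro s s' hss
      exact measureReal_mono (Set.inter_subset_inter_right _ fun x hx => lt_of_lt_of_le hx hss)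
        (hfin _)
    · intro a b t ht0 ht1
      have h1 : 0 < 1 - t := sub_pos.2 ht1
      have h := (prekopaLeindler_euclideanSpace ι).measure_le ht0 ht1 (hTm.inter (hlm a))
        (hTm.inter (hlm b)) (hTm.inter (hlm ((1 - t) * a + t * b))) (by
          rintro x ⟨hx, hxa⟩ w ⟨hw, hwb⟩
          refine ⟨hconv hx hw h1.le ht0.le (by ring), ?_⟩
          simp only [Set.mem_ofPred_eq, map_add, map_smul, smul_eq_mul] at hxa hwb ⊢
          exact add_lt_add (mul_lt_mul_of_pos_left hxa h1) (mul_lt_mul_of_pos_left hwb ht0))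
      have h2 := ENNReal.toReal_mono (hfin _) h
      rwa [ENNReal.toReal_mul, ← ENNReal.toReal_rpow, ← ENNReal.toReal_rpow] at h2
    · have hci : Integrable (fun _ => M) (volume.restrict T) := integrableOn_const hTfin
      have h1 : M * volume.real T < ∫ x in T, (M - l x) := by
        rw [integral_sub hci hlint, setIntegral_const, smul_eq_mul]
        linarith
      have hnn : 0 ≤ᵐ[volume.restrict T] fun x => M - l x := by
        filter_upwards [ae_restrict_mem hTm] with x hx
        exact sub_nonneg.2 (hlM x hx).le
      have hgi : Integrable (fun x => M - l x) (volume.restrict T) :=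
        hci.sub hlint
      calc ENNReal.ofReal (M * volume.real T) < ENNReal.ofReal (∫ x in T, (M - l x)) :=
            (ENNReal.ofReal_lt_ofReal_iff (lt_of_le_of_lt (by positivity) h1)).2 h1
        _ = ∫⁻ u in Set.Ioi 0, (volume.restrict T) {x | u < M - l x} := by
            rw [ofReal_integral_eq_lintegral_ofReal hgi hnn,
              lintegral_eq_lintegral_meas_lt _ hnn hgi.aemeasurable]
        _ = ∫⁻ u in Set.Ioi 0, ENNReal.ofReal (F (M - u)) := by
            refine lintegral_congr fun u => ?_
            have : {x | u < M - l x} = {x | l x < M - u} := by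
              ext x
              simp only [Set.mem_ofPred_eq]
              exact lt_sub_comm
            rw [this, Measure.restrict_apply (hlm _), Set.inter_comm, hFdef,
              ofReal_measureReal (hfin _)]
  have hsum : volume.real (T ∩ {x | l x < 0}) + volume.real (T ∩ {x | 0 ≤ l x}) =
      volume.real T := by
    have : T ∩ {x | 0 ≤ l x} = T \ {x | l x < 0} := by
      ext x
      simp
    rw [this, measureReal_inter_add_sdiff (hlm 0) hTfin]
  have : (1 - 1 / Real.exp 1) * volume.real T =
      volume.real T - volume.real T / Real.exp 1 := by ring
  rw [this]
  simp only [hFdef] at hkey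
  linarith


/-! ### Cuts by data points -/

theorem isLinearMap_uPrime {P d : ℕ} (i : Fin P) :
    IsLinearMap ℝ fun θ : Param P d => uPrime θ i :=
  ⟨fun _ _ => rfl, fun _ _ => rfl⟩

theorem isLinearMap_uBlock {P d : ℕ} (i : Fin P) :
    IsLinearMap ℝ fun θ : Param P d => uBlock θ i :=
  ⟨fun _ _ => rfl, fun _ _ => rfl⟩

theorem isLinearMap_mulVec_comp {E : Type*} [AddCommGroup E] [Module ℝ E] {n d : ℕ}
    {u : E → Fin d → ℝ} (hu : IsLinearMap ℝ u) (A : Matrix (Fin n) (Fin d) ℝ) (k : Fin n) :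
    IsLinearMap ℝ fun θ => A.mulVec (u θ) k :=
  ((LinearMap.proj k).comp (A.mulVecLin.comp hu.mk')).isLinear

theorem isLinearMap_label_mul_twoLayer {n d P : ℕ} (X : Matrix (Fin n) (Fin d) ℝ)
    (D : Fin P → activationPatterns X) (c : ℝ) (k : Fin n) :
    IsLinearMap ℝ fun θ : Param P d => c * twoLayer X D θ k := by
  convert! (c • (LinearMap.proj k).comp (∑ i, ((D i : Matrix (Fin n) (Fin n) ℝ) * X).mulVecLin.comp
    ((isLinearMap_uPrime i).mk' - (isLinearMap_uBlock i).mk'))).isLinear using 1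
  ext θ
  simp [twoLayer]

theorem isClosed_and_convex_halfSpace {E : Type*} [NormedAddCommGroup E] [NormedSpace ℝ E]
    [FiniteDimensional ℝ E] {f : E → ℝ} (hf : IsLinearMap ℝ f) :
    IsClosed {x | 0 ≤ f x} ∧ Convex ℝ {x | 0 ≤ f x} :=
  ⟨isClosed_le continuous_const hf.mk'.continuous_of_finiteDimensional,
    convex_halfSpace_ge hf 0⟩

theorem isCompact_and_convex_cutKept {n d P : ℕ} (X : Matrix (Fin n) (Fin d) ℝ) (y : Fin n → ℝ)
    (D : Fin P → activationPatterns X) {T : Set (Param P d)} (hT : IsCompact T)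
    (hconv : Convex ℝ T) (k : Fin n) :
    IsCompact (cutKept X y D T k) ∧ Convex ℝ (cutKept X y D T k) := by
  have h1 := isClosed_and_convex_halfSpace (isLinearMap_label_mul_twoLayer X D (y k) k)
  have h2 := fun i => isClosed_and_convex_halfSpace (isLinearMap_mulVec_comp
    (isLinearMap_uBlock i) ((2 * (D i : Matrix (Fin n) (Fin n) ℝ) - 1) * X) k)
  have h3 := fun i => isClosed_and_convex_halfSpace (isLinearMap_mulVec_comp
    (isLinearMap_uPrime i) ((2 * (D i : Matrix (Fin n) (Fin n) ℝ) - 1) * X) k)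
  have heq : cutKept X y D T k = T ∩ ({θ | 0 ≤ y k * twoLayer X D θ k} ∩
      ((⋂ i, {θ | 0 ≤ ((2 * (D i : Matrix (Fin n) (Fin n) ℝ) - 1) * X).mulVec (uBlock θ i) k}) ∩
      ⋂ i, {θ | 0 ≤ ((2 * (D i : Matrix (Fin n) (Fin n) ℝ) - 1) * X).mulVec (uPrime θ i) k})) := by
    ext θ
    simp only [cutKept, reluC, reluC', Set.mem_inter_iff, Set.mem_iInter, Set.mem_ofPred_eq]
  rw [heq]
  exact ⟨hT.inter_right (h1.1.inter ((isClosed_iInter fun i => (h2 i).1).inter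
      (isClosed_iInter fun i => (h3 i).1))),
    hconv.inter (h1.2.inter ((convex_iInter fun i => (h2 i).2).inter
      (convex_iInter fun i => (h3 i).2)))⟩

theorem volume_cutKept_lt {n d P : ℕ} (X : Matrix (Fin n) (Fin d) ℝ) (y : Fin n → ℝ)
    (D : Fin P → activationPatterns X) {T : Set (Param P d)} (hT : IsCompact T)
    (hconv : Convex ℝ T) {k : Fin n} (hact : IsActive X y D T k) :
    volume.real (cutKept X y D T k) < (1 - 1 / Real.exp 1) * volume.real T := by
  have hlin := isLinearMap_label_mul_twoLayer X D (y k) k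
  set l : Param P d →L[ℝ] ℝ := LinearMap.toContinuousLinearMap hlin.mk' with hl
  have hl_apply : ∀ θ, l θ = y k * twoLayer X D θ k := fun θ => rfl
  have hneg : l (centroid T) < 0 := hact
  have hint : IntegrableOn (fun θ : Param P d => θ) T :=
    continuous_id.continuousOn.integrableOn_compact hT
  rw [centroid, map_smul, smul_eq_mul, ← l.integral_comp_comm hint] at hneg
  -- With volume zero the centroid would be `0`, where `l` vanishes, contradicting activity.
  have hV : 0 < volume.real T := by
    refine measureReal_nonneg.lt_of_ne fun h => ?_
    rw [← h] at hneg
    simp at hneg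
  have hI : ∫ θ in T, l θ < 0 := by
    by_contra! h
    exact absurd hneg (not_lt.2 (by positivity))
  refine lt_of_le_of_lt (measureReal_mono ?_ ?_) (volume_halfSpace_lt hT hconv hV l hI)
  · rintro θ ⟨hθ, h, -⟩
    exact ⟨hθ, h⟩
  · exact ne_top_of_le_ne_top hT.measure_lt_top.ne (measure_mono Set.inter_subset_left)

end CuttingPlane

theorem theorem3 {n d P : ℕ} (X : Matrix (Fin n) (Fin d) ℝ) (y : Fin n → ℝ)
    (hy : ∀ k, y k = 1 ∨ y k = -1) (D : Fin P → CuttingPlane.activationPatterns X) :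
    -- one active cut
    (∀ (T : Set (CuttingPlane.Param P d)) (k : Fin n),
      CuttingPlane.IsConvexBody T → CuttingPlane.IsActive X y D T k →
        CuttingPlane.cutKept X y D T k ∪ CuttingPlane.cutDiscarded X y D T k = T ∧
        Disjoint (CuttingPlane.cutKept X y D T k) (CuttingPlane.cutDiscarded X y D T k) ∧
        volume.real (CuttingPlane.cutKept X y D T k) <
          (1 - 1 / Real.exp 1) * volume.real T) ∧
    -- `t` successive active cuts, made by the data points `k 0, …, k (t - 1)`
    (∀ (t : ℕ) (T : ℕ → Set (CuttingPlane.Param P d)) (k : ℕ → Fin n),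
      1 ≤ t → CuttingPlane.IsConvexBody (T 0) →
      (∀ s < t, CuttingPlane.IsActive X y D (T s) (k s) ∧
        T (s + 1) = CuttingPlane.cutKept X y D (T s) (k s)) →
        volume.real (T t) < (1 - 1 / Real.exp 1) ^ t * volume.real (T 0)) := by
  refine ⟨fun T k hT hact => ⟨?_, ?_, ?_⟩, fun t T k ht hT hcut => ?_⟩
  · ext θ
    simp only [CuttingPlane.cutKept, CuttingPlane.cutDiscarded, Set.mem_union, Set.mem_ofPred_eq,
      ← not_le]
    tauto
  · refine Set.disjoint_left.2 ?_
    rintro θ ⟨-, h1, h2, h3⟩ ⟨-, h | h | h⟩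
    · exact absurd h1 (not_le.2 h)
    · exact h h2
    · exact h h3
  · exact CuttingPlane.volume_cutKept_lt X y D hT.isCompact hT.convex hact
  · have hbody : ∀ s ≤ t, IsCompact (T s) ∧ Convex ℝ (T s) := by
      intro s
      induction s with
      | zero => exact fun _ => ⟨hT.isCompact, hT.convex⟩
      | succ s ih =>
        intro hs
        obtain ⟨hc, hv⟩ := ih (by omega)
        rw [(hcut s hs).2]
        exact CuttingPlane.isCompact_and_convex_cutKept X y D hc hv (k s)
    have hstep : ∀ s < t, volume.real (T (s + 1)) <
        (1 - 1 / Real.exp 1) * volume.real (T s) := by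
      intro s hs
      obtain ⟨hc, hv⟩ := hbody s hs.le
      obtain ⟨hact, heq⟩ := hcut s hs
      rw [heq]
      exact CuttingPlane.volume_cutKept_lt X y D hc hv hact
    have hq : 0 < 1 - 1 / Real.exp 1 := by
      rw [sub_pos, div_lt_one (Real.exp_pos 1)]
      exact Real.one_lt_exp_iff.2 one_pos
    -- The induction starts at one cut, since the strict inequality fails at exponent `0`.
    have hiter : ∀ s, s + 1 ≤ t → volume.real (T (s + 1)) <
        (1 - 1 / Real.exp 1) ^ (s + 1) * volume.real (T 0) := by
      intro s
      induction s with
      | zero => intro hs; simpa using hstep 0 hs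
      | succ s ih =>
        intro hs
        refine (hstep (s + 1) hs).trans ?_
        rw [pow_succ' _ (s + 1), mul_assoc]
        exact mul_lt_mul_of_pos_left (ih (by omega)) hq
    obtain ⟨s, rfl⟩ := Nat.exists_eq_add_of_le' ht
    exact hiter s le_rfl
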